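/- Rings are associative, not necessarily with unity. A nonzero ring $R$ is prime if, for $a,b\in R$, $aRb=0$ implies $a=0$ or $b=0$. For a prime ring $R$, let $Q_s(R)$ be its Martindale symmetric ring of quotients, let $C$ be the extended centroid of $R$, that is, the center of $Q_s(R)$ (a field), and let $RC\subseteq Q_s(R)$ be the $C$-subspace spanned by $R$, which is a subring. The prime ring $R$ is called exceptional if $\operatorname{char} R=2$ and $\dim_C RC=4$. Write $[x,y]=xy-yx$. For additive subgroups $A,B$ of $Q_s(R)$ let $[A,B]$ be the additive subgroup generated by all $[x,y]$ with $x\in A$, $y\in B$. A Lie ideal of $RC$ is an additive subgroup $L\subseteq RC$ with $[L,RC]\subseteq L$. **Theorem.** Let $R$ be a noncommutative prime ring. Then the following are equivalent: (i) $Ca+C$ is a Lie ideal of $RC$ for every $a\in[RC,RC]\setminus C$; (ii) $R$ is exceptional. -/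

import Mathlib

/-- A (not necessarily unital) associative ring is *prime* if it is nonzero and `a R b = 0` implies
`a = 0` or `b = 0`. -/
class IsPrimeRing (R : Type*) [NonUnitalRing R] : Prop extends Nontrivial R where
  eq_zero_or_eq_zero : ∀ a b : R, (∀ r : R, a * r * b = 0) → a = 0 ∨ b = 0

namespace TwoSidedIdeal

/-- The product `I * I`: all finite sums of products of two elements of `I`. -/
def square {R : Type*} [NonUnitalRing R] (I : TwoSidedIdeal R) : TwoSidedIdeal R :=
  TwoSidedIdeal.mk' (AddSubgroup.closure {z : R | ∃ x ∈ I, ∃ y ∈ I, z = x * y})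
    (AddSubgroup.zero_mem _) (fun hx hy => AddSubgroup.add_mem _ hx hy) (fun hx => AddSubgroup.neg_mem _ hx)
    (fun {s z} hz => by
      refine AddSubgroup.closure_induction
        (p := fun z _ => s * z ∈ AddSubgroup.closure {z : R | ∃ x ∈ I, ∃ y ∈ I, z = x * y})
        ?_ ?_ ?_ ?_ hz
      · rintro _ ⟨x, hx, y, hy, rfl⟩
        exact AddSubgroup.subset_closure ⟨s * x, I.mul_mem_left _ _ hx, y, hy, by rw [mul_assoc]⟩
      · simp
      · intro u v _ _ hu hv
        rw [mul_add]; exact AddSubgroup.add_mem _ hu hv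
      · intro u _ hu
        rw [mul_neg]; exact AddSubgroup.neg_mem _ hu)
    (fun {z s} hz => by
      refine AddSubgroup.closure_induction
        (p := fun z _ => z * s ∈ AddSubgroup.closure {z : R | ∃ x ∈ I, ∃ y ∈ I, z = x * y})
        ?_ ?_ ?_ ?_ hz
      · rintro _ ⟨x, hx, y, hy, rfl⟩
        exact AddSubgroup.subset_closure ⟨x, hx, y * s, I.mul_mem_right _ _ hy, by rw [mul_assoc]⟩
      · simp
      · intro u v _ _ hu hv
        rw [add_mul]; exact AddSubgroup.add_mem _ hu hv
      · intro u _ hu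
        rw [neg_mul]; exact AddSubgroup.neg_mem _ hu)

theorem mem_square_iff {R : Type*} [NonUnitalRing R] (I : TwoSidedIdeal R) (z : R) :
    z ∈ I.square ↔ z ∈ AddSubgroup.closure {z : R | ∃ x ∈ I, ∃ y ∈ I, z = x * y} := by
  unfold square
  rw [TwoSidedIdeal.mem_mk']
  rfl

theorem mul_mem_square {R : Type*} [NonUnitalRing R] (I : TwoSidedIdeal R) {x y : R}
    (hx : x ∈ I) (hy : y ∈ I) : x * y ∈ I.square :=
  (I.mem_square_iff _).2 (AddSubgroup.subset_closure ⟨x, hx, y, hy, rfl⟩)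

theorem square_le {R : Type*} [NonUnitalRing R] (I : TwoSidedIdeal R) : I.square ≤ I := by
  intro z hz
  refine AddSubgroup.closure_induction (p := fun z _ => z ∈ I) ?_ ?_ ?_ ?_
    ((I.mem_square_iff _).1 hz)
  · rintro _ ⟨x, _, y, hy, rfl⟩
    exact I.mul_mem_left _ _ hy
  · exact I.zero_mem
  · intro u v _ _ hu hv
    exact I.add_mem hu hv
  · intro u _ hu
    exact I.neg_mem hu

theorem exists_ne_zero_of_ne_bot {R : Type*} [NonUnitalRing R] {I : TwoSidedIdeal R}
    (hI : I ≠ ⊥) : ∃ x ∈ I, x ≠ 0 := by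
  by_contra! h
  exact hI (le_bot_iff.1 fun x hx => (TwoSidedIdeal.mem_bot R).2 (h x hx))

theorem ne_bot_of_mem {R : Type*} [NonUnitalRing R] {I : TwoSidedIdeal R} {x : R}
    (hx : x ∈ I) (h : x ≠ 0) : I ≠ ⊥ := by
  rintro rfl
  exact h ((TwoSidedIdeal.mem_bot R).1 hx)

theorem square_ne_bot {R : Type*} [NonUnitalRing R] [IsPrimeRing R] {I : TwoSidedIdeal R}
    (hI : I ≠ ⊥) : I.square ≠ ⊥ := by
  obtain ⟨x, hx, h0⟩ := exists_ne_zero_of_ne_bot hI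
  have : ∃ r, x * r * x ≠ 0 := by
    by_contra! h
    rcases IsPrimeRing.eq_zero_or_eq_zero x x h with h | h <;> exact h0 h
  obtain ⟨r, hr⟩ := this
  exact ne_bot_of_mem (I.mul_mem_square (I.mul_mem_right _ _ hx) hx) hr

theorem inf_ne_bot {R : Type*} [NonUnitalRing R] [IsPrimeRing R] {I J : TwoSidedIdeal R}
    (hI : I ≠ ⊥) (hJ : J ≠ ⊥) : I ⊓ J ≠ ⊥ := by
  obtain ⟨x, hx, hx0⟩ := exists_ne_zero_of_ne_bot hI
  obtain ⟨y, hy, hy0⟩ := exists_ne_zero_of_ne_bot hJ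
  have : ∃ r, x * r * y ≠ 0 := by
    by_contra! h
    rcases IsPrimeRing.eq_zero_or_eq_zero x y h with h | h
    exacts [hx0 h, hy0 h]
  obtain ⟨r, hr⟩ := this
  refine ne_bot_of_mem (x := x * r * y) ?_ hr
  rw [TwoSidedIdeal.mem_inf]
  exact ⟨I.mul_mem_right _ _ (I.mul_mem_right _ _ hx), J.mul_mem_left _ _ hy⟩

end TwoSidedIdeal

namespace PrimeRing

/-- A balanced pair on a nonzero ideal `dom` of `R`: a right `R`-module map `l : dom → R`
("multiplication by `q` from the left", `y ↦ q y`) and a left `R`-module map `r : dom → R`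
("multiplication by `q` from the right", `x ↦ x q`), with `x (q y) = (x q) y`.
The maps are stored as functions on all of `R`; their values outside `dom` carry no information. -/
structure BalancedPair (R : Type*) [NonUnitalRing R] where
  dom : TwoSidedIdeal R
  dom_ne_bot : dom ≠ ⊥
  l : R → R
  r : R → R
  l_add : ∀ x ∈ dom, ∀ y ∈ dom, l (x + y) = l x + l y
  l_mul : ∀ x ∈ dom, ∀ s : R, l (x * s) = l x * s
  r_add : ∀ x ∈ dom, ∀ y ∈ dom, r (x + y) = r x + r y
  r_mul : ∀ x ∈ dom, ∀ s : R, r (s * x) = s * r x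
  balanced : ∀ x ∈ dom, ∀ y ∈ dom, x * l y = r x * y

namespace BalancedPair

/-- Two balanced pairs are equivalent if they agree on a nonzero ideal contained in both domains. -/
def Rel {R : Type*} [NonUnitalRing R] (p q : BalancedPair R) : Prop :=
  ∃ K : TwoSidedIdeal R, K ≠ ⊥ ∧ K ≤ p.dom ∧ K ≤ q.dom ∧
    ∀ x ∈ K, p.l x = q.l x ∧ p.r x = q.r x

instance setoid (R : Type*) [NonUnitalRing R] [IsPrimeRing R] : Setoid (BalancedPair R) where
  r := Rel
  iseqv :=
    { refl := fun p => ⟨p.dom, p.dom_ne_bot, le_rfl, le_rfl, fun _ _ => ⟨rfl, rfl⟩⟩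
      symm := fun ⟨K, h0, h1, h2, h⟩ =>
        ⟨K, h0, h2, h1, fun x hx => ⟨(h x hx).1.symm, (h x hx).2.symm⟩⟩
      trans := fun ⟨K, h0, h1, _, h⟩ ⟨K', h0', _, h2', h'⟩ =>
        ⟨K ⊓ K', TwoSidedIdeal.inf_ne_bot h0 h0', inf_le_left.trans h1, inf_le_right.trans h2',
          fun x hx =>
            have hx' := (TwoSidedIdeal.mem_inf R).1 hx
            ⟨(h x hx'.1).1.trans (h' x hx'.2).1, (h x hx'.1).2.trans (h' x hx'.2).2⟩⟩ }

variable {R : Type*} [NonUnitalRing R]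

theorem l_zero (p : BalancedPair R) : p.l 0 = 0 := by
  have h := p.l_add 0 p.dom.zero_mem 0 p.dom.zero_mem
  rw [add_zero] at h
  exact left_eq_add.1 h

theorem r_zero (p : BalancedPair R) : p.r 0 = 0 := by
  have h := p.r_add 0 p.dom.zero_mem 0 p.dom.zero_mem
  rw [add_zero] at h
  exact left_eq_add.1 h

theorem l_neg (p : BalancedPair R) {x : R} (hx : x ∈ p.dom) : p.l (-x) = -p.l x := by
  have h := p.l_add x hx (-x) (p.dom.neg_mem hx)
  rw [add_neg_cancel, l_zero] at h
  exact (neg_eq_of_add_eq_zero_right h.symm).symm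

theorem r_neg (p : BalancedPair R) {x : R} (hx : x ∈ p.dom) : p.r (-x) = -p.r x := by
  have h := p.r_add x hx (-x) (p.dom.neg_mem hx)
  rw [add_neg_cancel, r_zero] at h
  exact (neg_eq_of_add_eq_zero_right h.symm).symm

theorem l_mem_of_mem_square (p : BalancedPair R) {J : TwoSidedIdeal R} (hJ : J ≤ p.dom) {z : R}
    (hz : z ∈ J.square) : p.l z ∈ J := by
  have key : z ∈ J ∧ p.l z ∈ J := by
    refine AddSubgroup.closure_induction (p := fun z _ => z ∈ J ∧ p.l z ∈ J) ?_ ?_ ?_ ?_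
      ((J.mem_square_iff _).1 hz)
    · rintro _ ⟨x, hx, y, hy, rfl⟩
      refine ⟨J.mul_mem_left _ _ hy, ?_⟩
      rw [p.l_mul x (hJ hx)]
      exact J.mul_mem_left _ _ hy
    · exact ⟨J.zero_mem, by rw [l_zero]; exact J.zero_mem⟩
    · rintro u v _ _ ⟨hu, hu'⟩ ⟨hv, hv'⟩
      refine ⟨J.add_mem hu hv, ?_⟩
      rw [p.l_add u (hJ hu) v (hJ hv)]
      exact J.add_mem hu' hv'
    · rintro u _ ⟨hu, hu'⟩
      refine ⟨J.neg_mem hu, ?_⟩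
      rw [p.l_neg (hJ hu)]
      exact J.neg_mem hu'
  exact key.2

theorem r_mem_of_mem_square (p : BalancedPair R) {J : TwoSidedIdeal R} (hJ : J ≤ p.dom) {z : R}
    (hz : z ∈ J.square) : p.r z ∈ J := by
  have key : z ∈ J ∧ p.r z ∈ J := by
    refine AddSubgroup.closure_induction (p := fun z _ => z ∈ J ∧ p.r z ∈ J) ?_ ?_ ?_ ?_
      ((J.mem_square_iff _).1 hz)
    · rintro _ ⟨x, hx, y, hy, rfl⟩
      refine ⟨J.mul_mem_left _ _ hy, ?_⟩
      rw [p.r_mul y (hJ hy)]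
      exact J.mul_mem_right _ _ hx
    · exact ⟨J.zero_mem, by rw [r_zero]; exact J.zero_mem⟩
    · rintro u v _ _ ⟨hu, hu'⟩ ⟨hv, hv'⟩
      refine ⟨J.add_mem hu hv, ?_⟩
      rw [p.r_add u (hJ hu) v (hJ hv)]
      exact J.add_mem hu' hv'
    · rintro u _ ⟨hu, hu'⟩
      refine ⟨J.neg_mem hu, ?_⟩
      rw [p.r_neg (hJ hu)]
      exact J.neg_mem hu'
  exact key.2

/-- Multiplication by an element `a` of `R`. -/
def ofElem [IsPrimeRing R] (a : R) : BalancedPair R where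
  dom := ⊤
  dom_ne_bot := by
    obtain ⟨x, hx⟩ := exists_ne (0 : R)
    exact TwoSidedIdeal.ne_bot_of_mem (TwoSidedIdeal.mem_top R) hx
  l := fun y => a * y
  r := fun x => x * a
  l_add := fun _ _ _ _ => mul_add _ _ _
  l_mul := fun _ _ _ => (mul_assoc _ _ _).symm
  r_add := fun _ _ _ _ => add_mul _ _ _
  r_mul := fun _ _ _ => mul_assoc _ _ _
  balanced := fun _ _ _ _ => (mul_assoc _ _ _).symm

/-- The identity pair. -/
def one [IsPrimeRing R] : BalancedPair R where
  dom := ⊤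
  dom_ne_bot := (ofElem (0 : R)).dom_ne_bot
  l := fun y => y
  r := fun x => x
  l_add := fun _ _ _ _ => rfl
  l_mul := fun _ _ _ => rfl
  r_add := fun _ _ _ _ => rfl
  r_mul := fun _ _ _ => rfl
  balanced := fun _ _ _ _ => rfl

/-- Pointwise sum, on the intersection of the domains. -/
def add [IsPrimeRing R] (p q : BalancedPair R) : BalancedPair R where
  dom := p.dom ⊓ q.dom
  dom_ne_bot := TwoSidedIdeal.inf_ne_bot p.dom_ne_bot q.dom_ne_bot
  l := fun y => p.l y + q.l y
  r := fun x => p.r x + q.r x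
  l_add := fun x hx y hy => by
    rw [TwoSidedIdeal.mem_inf] at hx hy
    rw [p.l_add x hx.1 y hy.1, q.l_add x hx.2 y hy.2, add_add_add_comm]
  l_mul := fun x hx s => by
    rw [TwoSidedIdeal.mem_inf] at hx
    rw [p.l_mul x hx.1, q.l_mul x hx.2, add_mul]
  r_add := fun x hx y hy => by
    rw [TwoSidedIdeal.mem_inf] at hx hy
    rw [p.r_add x hx.1 y hy.1, q.r_add x hx.2 y hy.2, add_add_add_comm]
  r_mul := fun x hx s => by
    rw [TwoSidedIdeal.mem_inf] at hx
    rw [p.r_mul x hx.1, q.r_mul x hx.2, mul_add]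
  balanced := fun x hx y hy => by
    rw [TwoSidedIdeal.mem_inf] at hx hy
    rw [mul_add, add_mul, p.balanced x hx.1 y hy.1, q.balanced x hx.2 y hy.2]

/-- Pointwise negation. -/
def neg (p : BalancedPair R) : BalancedPair R where
  dom := p.dom
  dom_ne_bot := p.dom_ne_bot
  l := fun y => -p.l y
  r := fun x => -p.r x
  l_add := fun x hx y hy => by rw [p.l_add x hx y hy, neg_add]
  l_mul := fun x hx s => by rw [p.l_mul x hx, neg_mul]
  r_add := fun x hx y hy => by rw [p.r_add x hx y hy, neg_add]
  r_mul := fun x hx s => by rw [p.r_mul x hx, mul_neg]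
  balanced := fun x hx y hy => by rw [mul_neg, neg_mul, p.balanced x hx y hy]

/-- Composition: `y ↦ p (q y)` and `x ↦ (x p) q`, on the square of the intersection of the
domains. -/
def mul [IsPrimeRing R] (p q : BalancedPair R) : BalancedPair R where
  dom := (p.dom ⊓ q.dom).square
  dom_ne_bot := TwoSidedIdeal.square_ne_bot
    (TwoSidedIdeal.inf_ne_bot p.dom_ne_bot q.dom_ne_bot)
  l := fun y => p.l (q.l y)
  r := fun x => q.r (p.r x)
  l_add := fun x hx y hy => by
    rw [q.l_add x (inf_le_right (a := p.dom) (TwoSidedIdeal.square_le _ hx))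
        y (inf_le_right (a := p.dom) (TwoSidedIdeal.square_le _ hy)),
      p.l_add _ (inf_le_left (b := q.dom) (q.l_mem_of_mem_square inf_le_right hx))
        _ (inf_le_left (b := q.dom) (q.l_mem_of_mem_square inf_le_right hy))]
  l_mul := fun x hx s => by
    rw [q.l_mul x (inf_le_right (a := p.dom) (TwoSidedIdeal.square_le _ hx)),
      p.l_mul _ (inf_le_left (b := q.dom) (q.l_mem_of_mem_square inf_le_right hx))]
  r_add := fun x hx y hy => by
    rw [p.r_add x (inf_le_left (b := q.dom) (TwoSidedIdeal.square_le _ hx))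
        y (inf_le_left (b := q.dom) (TwoSidedIdeal.square_le _ hy)),
      q.r_add _ (inf_le_right (a := p.dom) (p.r_mem_of_mem_square inf_le_left hx))
        _ (inf_le_right (a := p.dom) (p.r_mem_of_mem_square inf_le_left hy))]
  r_mul := fun x hx s => by
    rw [p.r_mul x (inf_le_left (b := q.dom) (TwoSidedIdeal.square_le _ hx)),
      q.r_mul _ (inf_le_right (a := p.dom) (p.r_mem_of_mem_square inf_le_left hx))]
  balanced := fun x hx y hy => by
    rw [p.balanced x (inf_le_left (b := q.dom) (TwoSidedIdeal.square_le _ hx))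
        _ (inf_le_left (b := q.dom) (q.l_mem_of_mem_square inf_le_right hy)),
      q.balanced _ (inf_le_right (a := p.dom) (p.r_mem_of_mem_square inf_le_left hx))
        y (inf_le_right (a := p.dom) (TwoSidedIdeal.square_le _ hy))]

theorem equiv_of_eq_on [IsPrimeRing R] (p q : BalancedPair R)
    (h : ∀ x ∈ p.dom ⊓ q.dom, p.l x = q.l x ∧ p.r x = q.r x) : p ≈ q :=
  ⟨p.dom ⊓ q.dom, TwoSidedIdeal.inf_ne_bot p.dom_ne_bot q.dom_ne_bot,
    inf_le_left, inf_le_right, h⟩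

theorem add_congr [IsPrimeRing R] {p p' q q' : BalancedPair R} (hp : p ≈ p') (hq : q ≈ q') :
    add p q ≈ add p' q' := by
  obtain ⟨K, h0, h1, h2, h⟩ := hp
  obtain ⟨K', h0', h1', h2', h'⟩ := hq
  refine ⟨K ⊓ K', TwoSidedIdeal.inf_ne_bot h0 h0', inf_le_inf h1 h1', inf_le_inf h2 h2', ?_⟩
  intro x hx
  rw [TwoSidedIdeal.mem_inf] at hx
  simp only [add]
  rw [(h x hx.1).1, (h x hx.1).2, (h' x hx.2).1, (h' x hx.2).2]
  exact ⟨rfl, rfl⟩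

theorem neg_congr [IsPrimeRing R] {p p' : BalancedPair R} (hp : p ≈ p') : neg p ≈ neg p' := by
  obtain ⟨K, h0, h1, h2, h⟩ := hp
  refine ⟨K, h0, h1, h2, fun x hx => ?_⟩
  simp only [neg]
  rw [(h x hx).1, (h x hx).2]
  exact ⟨rfl, rfl⟩

theorem square_mono {I J : TwoSidedIdeal R} (h : I ≤ J) : I.square ≤ J.square := by
  intro z hz
  rw [TwoSidedIdeal.mem_square_iff] at hz ⊢
  refine AddSubgroup.closure_mono ?_ hz
  rintro _ ⟨x, hx, y, hy, rfl⟩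
  exact ⟨x, h hx, y, h hy, rfl⟩

theorem mul_congr [IsPrimeRing R] {p p' q q' : BalancedPair R} (hp : p ≈ p') (hq : q ≈ q') :
    mul p q ≈ mul p' q' := by
  obtain ⟨K, h0, h1, h2, h⟩ := hp
  obtain ⟨K', h0', h1', h2', h'⟩ := hq
  refine ⟨(K ⊓ K').square, TwoSidedIdeal.square_ne_bot (TwoSidedIdeal.inf_ne_bot h0 h0'),
    square_mono (inf_le_inf h1 h1'), square_mono (inf_le_inf h2 h2'), ?_⟩
  intro x hx
  have hx' := (TwoSidedIdeal.mem_inf R).1 (TwoSidedIdeal.square_le _ hx)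
  have hl := (TwoSidedIdeal.mem_inf R).1
    (q.l_mem_of_mem_square (J := K ⊓ K') (inf_le_right.trans h1') hx)
  have hr := (TwoSidedIdeal.mem_inf R).1
    (p.r_mem_of_mem_square (J := K ⊓ K') (inf_le_left.trans h1) hx)
  constructor
  · change p.l (q.l x) = p'.l (q'.l x)
    rw [← (h' x hx'.2).1, (h _ hl.1).1]
  · change q.r (p.r x) = q'.r (p'.r x)
    rw [← (h x hx'.1).2, (h' _ hr.2).2]

end BalancedPair

/-- The Martindale symmetric ring of quotients `Q_s(R)` of a prime ring `R`. -/
def SymmQuot (R : Type*) [NonUnitalRing R] [IsPrimeRing R] : Type _ :=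
  Quotient (BalancedPair.setoid R)

namespace SymmQuot

section Operations

variable (R : Type*) [NonUnitalRing R] [IsPrimeRing R]

instance instAdd : Add (SymmQuot R) :=
  ⟨Quotient.map₂ BalancedPair.add fun _ _ hp _ _ hq => BalancedPair.add_congr hp hq⟩

instance instZero : Zero (SymmQuot R) := ⟨Quotient.mk _ (BalancedPair.ofElem 0)⟩

instance instNeg : Neg (SymmQuot R) :=
  ⟨Quotient.map BalancedPair.neg fun _ _ hp => BalancedPair.neg_congr hp⟩

instance instMul : Mul (SymmQuot R) :=
  ⟨Quotient.map₂ BalancedPair.mul fun _ _ hp _ _ hq => BalancedPair.mul_congr hp hq⟩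

instance instOne : One (SymmQuot R) := ⟨Quotient.mk _ BalancedPair.one⟩

end Operations

instance instRing (R : Type*) [NonUnitalRing R] [IsPrimeRing R] : Ring (SymmQuot R) where
  nsmul := nsmulRec
  zsmul := zsmulRec
  add_assoc := by
    rintro ⟨p⟩ ⟨q⟩ ⟨s⟩
    exact Quotient.sound (BalancedPair.equiv_of_eq_on _ _ fun x _ =>
      ⟨add_assoc _ _ _, add_assoc _ _ _⟩)
  zero_add := by
    rintro ⟨p⟩
    refine Quotient.sound (BalancedPair.equiv_of_eq_on _ _ fun x _ => ?_)
    simp [BalancedPair.add, BalancedPair.ofElem]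
  add_zero := by
    rintro ⟨p⟩
    refine Quotient.sound (BalancedPair.equiv_of_eq_on _ _ fun x _ => ?_)
    simp [BalancedPair.add, BalancedPair.ofElem]
  add_comm := by
    rintro ⟨p⟩ ⟨q⟩
    exact Quotient.sound (BalancedPair.equiv_of_eq_on _ _ fun x _ =>
      ⟨add_comm _ _, add_comm _ _⟩)
  neg_add_cancel := by
    rintro ⟨p⟩
    refine Quotient.sound (BalancedPair.equiv_of_eq_on _ _ fun x _ => ?_)
    simp [BalancedPair.add, BalancedPair.neg, BalancedPair.ofElem]
  mul_assoc := by
    rintro ⟨p⟩ ⟨q⟩ ⟨s⟩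
    exact Quotient.sound (BalancedPair.equiv_of_eq_on _ _ fun x _ => ⟨rfl, rfl⟩)
  one_mul := by
    rintro ⟨p⟩
    exact Quotient.sound (BalancedPair.equiv_of_eq_on _ _ fun x _ => ⟨rfl, rfl⟩)
  mul_one := by
    rintro ⟨p⟩
    exact Quotient.sound (BalancedPair.equiv_of_eq_on _ _ fun x _ => ⟨rfl, rfl⟩)
  zero_mul := by
    rintro ⟨p⟩
    refine Quotient.sound (BalancedPair.equiv_of_eq_on _ _ fun x _ => ?_)
    simp [BalancedPair.mul, BalancedPair.ofElem, p.r_zero]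
  mul_zero := by
    rintro ⟨p⟩
    refine Quotient.sound (BalancedPair.equiv_of_eq_on _ _ fun x _ => ?_)
    simp [BalancedPair.mul, BalancedPair.ofElem, p.l_zero]
  left_distrib := by
    rintro ⟨p⟩ ⟨q⟩ ⟨s⟩
    refine Quotient.sound (BalancedPair.equiv_of_eq_on _ _ fun x hx => ?_)
    have hx := ((TwoSidedIdeal.mem_inf R).1
      ((TwoSidedIdeal.mem_inf R).1 hx).2)
    have hq := (TwoSidedIdeal.mem_inf R).1 (q.l_mem_of_mem_square inf_le_right hx.1)
    have hs := (TwoSidedIdeal.mem_inf R).1 (s.l_mem_of_mem_square inf_le_right hx.2)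
    exact ⟨p.l_add _ hq.1 _ hs.1, rfl⟩
  right_distrib := by
    rintro ⟨p⟩ ⟨q⟩ ⟨s⟩
    refine Quotient.sound (BalancedPair.equiv_of_eq_on _ _ fun x hx => ?_)
    have hx := ((TwoSidedIdeal.mem_inf R).1
      ((TwoSidedIdeal.mem_inf R).1 hx).2)
    have hp := (TwoSidedIdeal.mem_inf R).1 (p.r_mem_of_mem_square inf_le_left hx.1)
    have hq := (TwoSidedIdeal.mem_inf R).1 (q.r_mem_of_mem_square inf_le_left hx.2)
    exact ⟨rfl, s.r_add _ hp.2 _ hq.2⟩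

/-- The canonical ring homomorphism `R → Q_s(R)`, `a ↦` (multiplication by `a`). -/
def ofRing (R : Type*) [NonUnitalRing R] [IsPrimeRing R] : R →ₙ+* SymmQuot R where
  toFun a := Quotient.mk _ (BalancedPair.ofElem a)
  map_zero' := rfl
  map_add' _ _ := Quotient.sound (BalancedPair.equiv_of_eq_on _ _ fun _ _ =>
    ⟨add_mul _ _ _, mul_add _ _ _⟩)
  map_mul' _ _ := Quotient.sound (BalancedPair.equiv_of_eq_on _ _ fun _ _ =>
    ⟨mul_assoc _ _ _, (mul_assoc _ _ _).symm⟩)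

end SymmQuot

/-- The extended centroid `C` of `R`: the center of `Q_s(R)`. -/
abbrev ExtCentroid (R : Type*) [NonUnitalRing R] [IsPrimeRing R] : Subring (SymmQuot R) :=
  Subring.center (SymmQuot R)

/-- `RC`, as a `C`-subspace of `Q_s(R)`: all finite sums of products `r c`. -/
def centralClosure (R : Type*) [NonUnitalRing R] [IsPrimeRing R] :
    Submodule (ExtCentroid R) (SymmQuot R) :=
  Submodule.span (ExtCentroid R) (Set.range (SymmQuot.ofRing R))

/-- `char R = 2` (for rings possibly without unity: `2` is the least `n > 0` with `n R = 0`) and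
`dim_C RC = 4`. -/
def IsExceptional (R : Type*) [NonUnitalRing R] [IsPrimeRing R] : Prop :=
  AddMonoid.exponent R = 2 ∧ Module.finrank (ExtCentroid R) (centralClosure R) = 4

/-- `[A, B]`: the additive subgroup generated by all `a b - b a` with `a ∈ A`, `b ∈ B`. -/
def commutator {Q : Type*} [Ring Q] (A B : AddSubgroup Q) : AddSubgroup Q :=
  AddSubgroup.closure {x : Q | ∃ a ∈ A, ∃ b ∈ B, x = a * b - b * a}

/-- `L` is a Lie ideal of `S` (additive subgroups of `Q`; used for `S` closed under
multiplication): `L` is contained in `S` and `[L, S] ⊆ L`. -/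
def IsLieIdealOf {Q : Type*} [Ring Q] (L S : AddSubgroup Q) : Prop :=
  L ≤ S ∧ commutator L S ≤ L

/-- The additive subgroup `Ca + C` of `Q_s(R)`. -/
def affineLine {R : Type*} [NonUnitalRing R] [IsPrimeRing R] (a : SymmQuot R) :
    AddSubgroup (SymmQuot R) :=
  (Submodule.span (ExtCentroid R) {a} ⊔ Submodule.span (ExtCentroid R) {1}).toAddSubgroup

end PrimeRing

/-! Everything happens in the prime unital algebra `B = RC + C` over the field `F = C`, whose center
is `F`. Write `D_a = [a, ·]`.

From the Lie ideal condition to exceptionality (`two_eq_zero_and_finrank_eq_four`): if `[a, B] ⊆ Fa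
+ F`, then `D_a² = 0`, which in a prime algebra with `2 ≠ 0` forces `D_a = 0`; so the characteristic
is two. Some commutator `b ∉ F` satisfies `[b, x] = b`; its square is central, and then some `y` has
`[b, y] = 1`. Image and kernel of `D_b` are both `Fb + F`, so `dim B = 4`. The condition itself puts
`1 ∈ Ca + C` inside `RC`, so `B = RC`.

Conversely, a finite-dimensional `B` is simple (`IsPrimeRing.isSimpleRing_of_isArtinianRing`) and
has `RC` as a nonzero ideal, so again `B = RC`. For `a ∉ F` the centralizer of `a` is `Fa + F`
(`centralizer_eq_and_finrank_range_eq_two`), hence `a² = ta + n`, and in characteristic two `D_a² =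
tD_a`. The coefficient `t` acts as a trace: if `t ≠ 0`, all commutators lie in `[a, B] + F`
(`innerDer_mem_range_sup_one`), and `a` does not. So a sum of commutators has `t = 0`, `D_a² = 0`,
and `[a, B]` lies in the centralizer `Fa + F`. -/

/-- The inner derivation `x ↦ a x - x a`. -/
def innerDer (F : Type*) {B : Type*} [CommRing F] [Ring B] [Algebra F B] (a : B) : B →ₗ[F] B :=
  LinearMap.mulLeft F a - LinearMap.mulRight F a

section InnerDer

variable {F B : Type*} [CommRing F] [Ring B] [Algebra F B]

theorem innerDer_apply (a x : B) : innerDer F a x = a * x - x * a := rfl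

theorem innerDer_mul (a x y : B) :
    innerDer F a (x * y) = innerDer F a x * y + x * innerDer F a y := by
  simp only [innerDer_apply]; noncomm_ring

theorem innerDer_self_mul (a x : B) : innerDer F a (a * x) = a * innerDer F a x := by
  simp only [innerDer_apply]; noncomm_ring

theorem innerDer_innerDer (a x : B) :
    innerDer F a (innerDer F a x) = a * innerDer F a x - innerDer F a x * a := rfl

theorem innerDer_smul_add_smul_one (c d : F) (a x : B) :
    innerDer F (c • a + d • 1) x = c • innerDer F a x := by
  simp only [innerDer_apply, add_mul, mul_add, smul_mul_assoc, mul_smul_comm, one_mul, mul_one,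
    smul_sub]
  abel

end InnerDer

/-! ### Prime algebras in which commutators `a ∉ F` satisfy `[a, B] ⊆ Fa + F` -/

section SpanCommutators

variable {F B : Type*} [Field F] [Ring B] [Algebra F B]

theorem smul_add_smul_one_mem_range {c d : F} {a : B} (hc : c ≠ 0)
    (h : c • a + d • 1 ∈ Set.range (algebraMap F B)) : a ∈ Set.range (algebraMap F B) := by
  obtain ⟨e, he⟩ := h
  refine ⟨c⁻¹ * (e - d), ?_⟩
  rw [map_mul, map_sub, he, Algebra.algebraMap_eq_smul_one d, add_sub_cancel_right,
    ← Algebra.smul_def, smul_smul, inv_mul_cancel₀ hc, one_smul]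

theorem eq_zero_of_smul_add_smul_one_eq_zero [Nontrivial B] {c d : F} {a : B}
    (ha : a ∉ Set.range (algebraMap F B)) (h : c • a + d • 1 = 0) : c = 0 ∧ d = 0 := by
  have hc : c = 0 := by
    by_contra hc
    exact ha (smul_add_smul_one_mem_range hc (d := d) ⟨0, by rw [h, map_zero]⟩)
  subst hc
  rw [zero_smul, zero_add] at h
  exact ⟨rfl, (smul_eq_zero.1 h).resolve_right one_ne_zero⟩

theorem innerDer_eq_zero_of_mem_range {a : B} (ha : a ∈ Set.range (algebraMap F B)) (x : B) :
    innerDer F a x = 0 := by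
  obtain ⟨c, rfl⟩ := ha
  rw [innerDer_apply, Algebra.commutes, sub_self]

/-- In a noncommutative algebra with center `F`, some commutator is not in `F`. -/
theorem exists_commutator_notMem_range (hB : ∃ u v : B, u * v ≠ v * u) :
    ∃ u v : B, innerDer F u v ∉ Set.range (algebraMap F B) := by
  by_contra! h
  obtain ⟨u, v, huv⟩ := hB
  obtain ⟨c, hc⟩ := h u v
  have hc0 : c ≠ 0 := by
    rintro rfl
    rw [map_zero, innerDer_apply] at hc
    exact huv (sub_eq_zero.1 hc.symm)
  -- `[u, uv] = u[u, v] = cu`, so a nonzero scalar value `c` would make `u` itself scalar.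
  have h1 := h u (u * v)
  rw [innerDer_self_mul, ← hc, ← Algebra.commutes, ← Algebra.smul_def] at h1
  have hu : u ∈ Set.range (algebraMap F B) :=
    smul_add_smul_one_mem_range hc0 (d := 0) (by rwa [zero_smul, add_zero])
  have := innerDer_eq_zero_of_mem_range hu v
  rw [innerDer_apply] at this
  exact huv (sub_eq_zero.1 this)

/-- In a prime algebra in which `2` is invertible, an inner derivation whose square vanishes
is zero. -/
theorem innerDer_eq_zero_of_innerDer_innerDer [IsPrimeRing B] (h2 : (2 : F) ≠ 0) {a : B}
    (h : ∀ x, innerDer F a (innerDer F a x) = 0) (x : B) : innerDer F a x = 0 := by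
  -- Expanding `0 = D²(yz)` leaves only the cross term `2 D(y) D(z)`.
  have hmul : ∀ y z, innerDer F a y * innerDer F a z = 0 := by
    intro y z
    have := h (y * z)
    rw [innerDer_mul, map_add, innerDer_mul, innerDer_mul, h, h, zero_mul, mul_zero, zero_add,
      add_zero, ← two_smul F] at this
    exact (smul_eq_zero.1 this).resolve_left h2
  refine or_self_iff.1 (IsPrimeRing.eq_zero_or_eq_zero _ _ fun r => ?_)
  -- The Leibniz rule on `D(rx)` turns this into `D(x) r D(x) = 0`.
  have := hmul x (r * x)
  rwa [innerDer_mul, mul_add, ← mul_assoc, hmul, zero_mul, zero_add, ← mul_assoc] at this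

/-- If `[b, B] ⊆ F b + F` and `b` occurs in `[b, B]`, then `b ^ 2 ∈ F` forces `1` to occur too. -/
theorem exists_innerDer_eq_one [IsPrimeRing B] {b : B} (hb : b ∉ Set.range (algebraMap F B))
    (hspan : ∀ x, ∃ c d : F, innerDer F b x = c • b + d • 1)
    (hsq : b * b ∈ Set.range (algebraMap F B)) {x : B} (hx : innerDer F b x = b) :
    ∃ y, innerDer F b y = 1 := by
  have hb0 : b ≠ 0 := fun h => hb ⟨0, by rw [map_zero, h]⟩
  -- Otherwise `[b, B] ⊆ Fb`. Then `b² = [b, bx]` is both a scalar and a multiple of `b`, hence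
  -- zero, and `0 = b[b, r] = -brb` contradicts primeness.
  have key : ∃ y, ∃ c d : F, innerDer F b y = c • b + d • 1 ∧ d ≠ 0 := by
    by_contra! h
    have h' : ∀ y, ∃ c : F, innerDer F b y = c • b := fun y => by
      obtain ⟨c, d, e⟩ := hspan y
      exact ⟨c, by rw [e, h y c d e, zero_smul, add_zero]⟩
    have hbb : b * b = 0 := by
      obtain ⟨c, hc⟩ := h' (b * x)
      rw [innerDer_self_mul, hx] at hc
      have : c = 0 := by
        by_contra hc0
        exact hb (smul_add_smul_one_mem_range hc0 (d := 0)
          (by rwa [zero_smul, add_zero, ← hc]))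
      rw [hc, this, zero_smul]
    refine hb0 (or_self_iff.1 (IsPrimeRing.eq_zero_or_eq_zero b b fun r => ?_))
    obtain ⟨c, hc⟩ := h' r
    have h3 : b * innerDer F b r = 0 := by rw [hc, mul_smul_comm, hbb, smul_zero]
    rw [innerDer_apply, mul_sub, ← mul_assoc, hbb, zero_mul, zero_sub, neg_eq_zero,
      ← mul_assoc] at h3
    exact h3
  obtain ⟨y, c, d, hy, hd⟩ := key
  refine ⟨d⁻¹ • (y - c • x), ?_⟩
  rw [map_smul, map_sub, map_smul, hx, hy, add_sub_cancel_left, smul_smul, inv_mul_cancel₀ hd,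
    one_smul]

/-- Rank plus nullity of `D_b`: the image is `Fb + F`, with `x`, `y` lying over `b`, `1`, and the
kernel is `Fb + F` again. -/
theorem finrank_eq_four_of_innerDer [Nontrivial B] {b x y : B}
    (hb : b ∉ Set.range (algebraMap F B))
    (hspan : ∀ x, ∃ c d : F, innerDer F b x = c • b + d • 1)
    (hx : innerDer F b x = b) (hy : innerDer F b y = 1) : Module.finrank F B = 4 := by
  have hbb : innerDer F b b = 0 := by rw [innerDer_apply, sub_self]
  have h1 : innerDer F b 1 = 0 := by rw [innerDer_apply, mul_one, one_mul, sub_self]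
  -- If `z` commutes with `b`, then `z = z[b, y] = [b, zy]`.
  have hcent : ∀ z, innerDer F b z = 0 → ∃ c d : F, z = c • b + d • 1 := by
    intro z hz
    obtain ⟨c, d, h⟩ := hspan (z * y)
    rw [innerDer_mul, hz, hy, zero_mul, mul_one, zero_add] at h
    exact ⟨c, d, h⟩
  have hli : LinearIndependent F ![1, b, x, y] := by
    rw [Fintype.linearIndependent_iff]
    intro g hg
    simp only [Fin.sum_univ_four, Matrix.cons_val] at hg
    have h := congrArg (innerDer F b) hg
    simp only [map_add, map_smul, h1, hbb, hx, hy, smul_zero, zero_add, map_zero] at h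
    obtain ⟨h2, h3⟩ := eq_zero_of_smul_add_smul_one_eq_zero hb h
    rw [h2, h3, zero_smul, zero_smul, add_zero, add_zero, add_comm] at hg
    obtain ⟨h4, h5⟩ := eq_zero_of_smul_add_smul_one_eq_zero hb hg
    intro i
    fin_cases i <;> assumption
  have hsp : ⊤ ≤ Submodule.span F (Set.range ![1, b, x, y]) := by
    intro z _
    have hmem : ∀ i, ![1, b, x, y] i ∈ Submodule.span F (Set.range ![1, b, x, y]) :=
      fun i => Submodule.subset_span ⟨i, rfl⟩
    obtain ⟨c, d, h⟩ := hspan z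
    obtain ⟨c', d', h'⟩ := hcent (z - (c • x + d • y)) (by
      rw [map_sub, map_add, map_smul, map_smul, hx, hy, h, sub_self])
    rw [sub_eq_iff_eq_add.1 h']
    exact add_mem (add_mem (Submodule.smul_mem _ _ (hmem 1)) (Submodule.smul_mem _ _ (hmem 0)))
      (add_mem (Submodule.smul_mem _ _ (hmem 2)) (Submodule.smul_mem _ _ (hmem 3)))
  rw [Module.finrank_eq_card_basis (Module.Basis.mk hli hsp), Fintype.card_fin]

/-- A noncommutative prime algebra with center `F` in which `[a, B] ⊆ F a + F` for every
commutator `a ∉ F` has characteristic two and dimension four. -/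
theorem two_eq_zero_and_finrank_eq_four [IsPrimeRing B] (hB : ∃ u v : B, u * v ≠ v * u)
    (hc : ∀ z : B, (∀ x, z * x = x * z) → z ∈ Set.range (algebraMap F B))
    (H : ∀ u v : B, innerDer F u v ∉ Set.range (algebraMap F B) →
      ∀ x, ∃ c d : F, innerDer F (innerDer F u v) x = c • innerDer F u v + d • 1) :
    (2 : F) = 0 ∧ Module.finrank F B = 4 := by
  have hc' : ∀ z : B, (∀ x, innerDer F z x = 0) → z ∈ Set.range (algebraMap F B) :=
    fun z hz => hc z fun x => sub_eq_zero.1 (hz x)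
  have hDD : ∀ a : B, (∀ x, ∃ c d : F, innerDer F a x = c • a + d • 1) →
      ∀ x, innerDer F a (innerDer F a x) = 0 := by
    intro a ha x
    obtain ⟨c, d, h⟩ := ha x
    rw [h]
    simp only [innerDer_apply, mul_add, add_mul, smul_mul_assoc, mul_smul_comm, one_mul, mul_one,
      sub_self]
  obtain ⟨u, v, huv⟩ := exists_commutator_notMem_range (F := F) hB
  have h2 : (2 : F) = 0 := by
    by_contra h2
    exact huv (hc' _ (innerDer_eq_zero_of_innerDer_innerDer h2 (hDD _ (H u v huv))))
  refine ⟨h2, ?_⟩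
  set a := innerDer F u v
  -- If `[a, B] ⊆ F`, then `[a, ax] = a[a, x]` is a scalar, which for `a ∉ F` forces `[a, x] = 0`.
  obtain ⟨x₀, c, d, hx₀, hc0⟩ : ∃ x₀, ∃ c d : F, innerDer F a x₀ = c • a + d • 1 ∧ c ≠ 0 := by
    by_contra! h
    have h' : ∀ y, ∃ d : F, innerDer F a y = d • 1 := fun y => by
      obtain ⟨c, d, e⟩ := H u v huv y
      exact ⟨d, by rw [e, h y c d e, zero_smul, zero_add]⟩
    refine huv (hc' _ fun x => ?_)
    obtain ⟨d, hd⟩ := h' x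
    obtain ⟨e, he⟩ := h' (a * x)
    rw [innerDer_self_mul, hd, mul_smul_comm, mul_one] at he
    have : d = 0 := by
      by_contra hd0
      exact huv (smul_add_smul_one_mem_range hd0 (d := 0)
        ⟨e, by rw [zero_smul, add_zero, he, Algebra.algebraMap_eq_smul_one]⟩)
    rw [hd, this, zero_smul]
  -- Replace `a` by `b = [a, x₀] = ca + d`: again a commutator outside `F`, and it occurs in its own
  -- image, `[b, c⁻¹x₀] = b`.
  have hb : innerDer F a x₀ ∉ Set.range (algebraMap F B) := fun h =>
    huv (smul_add_smul_one_mem_range hc0 (hx₀ ▸ h))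
  have hspan := H a x₀ hb
  set b := innerDer F a x₀
  have hx : innerDer F b (c⁻¹ • x₀) = b := by
    rw [map_smul]
    nth_rw 1 [hx₀]
    rw [innerDer_smul_add_smul_one, smul_smul, inv_mul_cancel₀ hc0, one_smul]
  -- `b` commutes with `[b, z]`, so `[b², z] = 2b[b, z] = 0`.
  have hsq : b * b ∈ Set.range (algebraMap F B) := by
    refine hc' _ fun z => ?_
    have h3 := hDD b hspan z
    rw [innerDer_innerDer, sub_eq_zero] at h3
    have h4 : innerDer F (b * b) z = b * innerDer F b z + innerDer F b z * b := by
      simp only [innerDer_apply]; noncomm_ring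
    rw [h4, ← h3, ← two_smul F, h2, zero_smul]
  obtain ⟨y, hy⟩ := exists_innerDer_eq_one hb hspan hsq hx
  exact finrank_eq_four_of_innerDer hb hspan hx hy

end SpanCommutators

/-! ### Four-dimensional central simple algebras in characteristic two -/

section SimpleDimFour

/-- In a simple ring, a relation `p z + q z a = 0` with `q ≠ 0` forces `a` to be central. -/
theorem IsSimpleRing.commute_of_mul_add_mul_mul_eq_zero {B : Type*} [Ring B] [IsSimpleRing B]
    {p q a : B} (hq : q ≠ 0) (h : ∀ z, p * z + q * z * a = 0) (x : B) : a * x = x * a := by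
  -- The possible coefficients `w` form a two-sided ideal; for closure under right multiplication by
  -- `s`, put `sz` for `z`. Once `1 ∈ I`, taking `z = 1` gives `l = -a`.
  let I : TwoSidedIdeal B := TwoSidedIdeal.mk' {w | ∃ l, ∀ z, l * z + w * z * a = 0}
    ⟨0, fun z => by simp⟩
    (by
      rintro w w' ⟨l, hl⟩ ⟨l', hl'⟩
      refine ⟨l + l', fun z => ?_⟩
      rw [add_mul, add_mul, add_mul, add_add_add_comm, hl, hl', add_zero])
    (by
      rintro w ⟨l, hl⟩
      refine ⟨-l, fun z => ?_⟩
      rw [neg_mul, neg_mul, neg_mul, ← neg_add, hl, neg_zero])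
    (by
      rintro s w ⟨l, hl⟩
      refine ⟨s * l, fun z => ?_⟩
      rw [mul_assoc, mul_assoc, mul_assoc, ← mul_add, ← mul_assoc w, hl, mul_zero])
    (by
      rintro w s ⟨l, hl⟩
      refine ⟨l * s, fun z => ?_⟩
      rw [mul_assoc, mul_assoc w, hl])
  have hqI : q ∈ I := (TwoSidedIdeal.mem_mk' _ _ _ _ _ _ _).2 ⟨p, h⟩
  have htop : I = ⊤ := (eq_bot_or_eq_top I).resolve_left (TwoSidedIdeal.ne_bot_of_mem hqI hq)
  obtain ⟨l, hl⟩ := (TwoSidedIdeal.mem_mk' _ _ _ _ _ _ _).1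
    (show (1 : B) ∈ I from htop ▸ TwoSidedIdeal.mem_top B)
  have h1 := hl 1
  rw [mul_one, one_mul, one_mul] at h1
  have hx := hl x
  rw [eq_neg_of_add_eq_zero_left h1, one_mul, neg_mul, neg_add_eq_zero] at hx
  exact hx

variable {F B : Type*} [Field F] [Ring B] [Algebra F B]

/-- In a simple algebra, `(a - c) [a, B] = 0` with `c` a scalar only happens for central `a`. -/
theorem innerDer_eq_zero_of_mul_innerDer_eq_smul [IsSimpleRing B] {a : B} {c : F}
    (h : ∀ x, a * innerDer F a x = c • innerDer F a x) (x : B) : innerDer F a x = 0 := by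
  by_cases hq : a - algebraMap F B c = 0
  · rw [sub_eq_zero.1 hq]
    exact innerDer_eq_zero_of_mem_range ⟨c, rfl⟩ x
  · rw [innerDer_apply, sub_eq_zero]
    refine IsSimpleRing.commute_of_mul_add_mul_mul_eq_zero (neg_ne_zero.2 hq)
      (p := (a - algebraMap F B c) * a) (fun z => ?_) x
    have h1 : (a - algebraMap F B c) * innerDer F a z = 0 := by
      rw [sub_mul, h, Algebra.smul_def, sub_self]
    rw [innerDer_apply] at h1
    rw [← h1]
    noncomm_ring

/-- If `v = [a, y]` spanned the image, `[a, ay] = av` would be some `cv`. Then `a` acts on the image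
as the scalar `c`, which simplicity excludes. -/
theorem two_le_finrank_range_innerDer [IsSimpleRing B] [FiniteDimensional F B]
    (hc : ∀ z : B, (∀ x, innerDer F z x = 0) → z ∈ Set.range (algebraMap F B)) {a : B}
    (ha : a ∉ Set.range (algebraMap F B)) :
    2 ≤ Module.finrank F (LinearMap.range (innerDer F a)) := by
  by_contra! hlt
  obtain ⟨v, hv⟩ := finrank_le_one_iff.1 (Nat.lt_succ_iff.1 hlt)
  obtain ⟨x₀, hx₀⟩ : ∃ x₀, innerDer F a x₀ ≠ 0 := by
    by_contra! h
    exact ha (hc a h)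
  have hv' : ∀ x, ∃ c : F, innerDer F a x = c • (v : B) := fun x => by
    obtain ⟨c, hc⟩ := hv ⟨innerDer F a x, x, rfl⟩
    exact ⟨c, (congrArg Subtype.val hc).symm⟩
  obtain ⟨y, hy⟩ := v.2
  obtain ⟨c, hcy⟩ := hv' (a * y)
  rw [innerDer_self_mul, hy] at hcy
  refine ha (hc a (innerDer_eq_zero_of_mul_innerDer_eq_smul (c := c) fun x => ?_))
  obtain ⟨d, hd⟩ := hv' x
  rw [hd, mul_smul_comm, hcy, smul_comm]

/-- In a four-dimensional central simple algebra, the centralizer of `a ∉ F` is `F a + F`, and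
`[a, B]` is two-dimensional. -/
theorem centralizer_eq_and_finrank_range_eq_two [IsSimpleRing B] [FiniteDimensional F B]
    (hc : ∀ z : B, (∀ x, innerDer F z x = 0) → z ∈ Set.range (algebraMap F B))
    (h4 : Module.finrank F B = 4) {a : B} (ha : a ∉ Set.range (algebraMap F B)) :
    (∀ z, innerDer F a z = 0 → ∃ c d : F, z = c • a + d • 1) ∧
      Module.finrank F (LinearMap.range (innerDer F a)) = 2 := by
  have h2 := two_le_finrank_range_innerDer hc ha
  -- The rank is at least two and the kernel contains the independent `a`, `1`; a total of four
  -- forces equality in both.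
  have hsum := LinearMap.finrank_range_add_finrank_ker (innerDer F a)
  have hli : LinearIndependent F ![a, 1] :=
    LinearIndependent.pair_iff.2 fun s t h => eq_zero_of_smul_add_smul_one_eq_zero ha h
  have hspan : Module.finrank F (Submodule.span F {a, (1 : B)}) = 2 := by
    have := finrank_span_eq_card hli
    rwa [Matrix.range_cons_cons_empty, Fintype.card_fin] at this
  have hle : Submodule.span F {a, (1 : B)} ≤ LinearMap.ker (innerDer F a) := by
    rw [Submodule.span_le]
    rintro z (rfl | rfl)
    · exact sub_self _
    · simp [innerDer_apply]
  have hge := Submodule.finrank_mono hle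
  have heq := Submodule.eq_of_le_of_finrank_le hle (by omega)
  refine ⟨fun z hz => ?_, by omega⟩
  have hz' : z ∈ Submodule.span F {a, (1 : B)} := heq ▸ (LinearMap.mem_ker.2 hz)
  obtain ⟨c, d, h⟩ := Submodule.mem_span_pair.1 hz'
  exact ⟨c, d, h.symm⟩

/-- In a four-dimensional central simple algebra of characteristic two, an element `a ∉ F` with
`a ^ 2 = t a + n`, `t ≠ 0`, is not a sum of commutators: these all lie in `[a, B] + F`. -/
theorem innerDer_mem_range_sup_one [IsSimpleRing B] [FiniteDimensional F B]
    (h2 : (2 : F) = 0)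
    (hc : ∀ z : B, (∀ x, innerDer F z x = 0) → z ∈ Set.range (algebraMap F B))
    (h4 : Module.finrank F B = 4) {a : B} (ha : a ∉ Set.range (algebraMap F B)) {t n : F}
    (ht : t ≠ 0) (hsq : a * a = t • a + n • 1) (y z : B) :
    innerDer F y z ∈ LinearMap.range (innerDer F a) ⊔ Submodule.span F {(1 : B)} := by
  obtain ⟨hcent, hV⟩ := centralizer_eq_and_finrank_range_eq_two hc h4 ha
  have htwo : ∀ x : B, x + x = 0 := fun x => by rw [← two_smul F, h2, zero_smul]
  have hneg : ∀ x : B, -x = x := fun x => neg_eq_of_add_eq_zero_left (htwo x)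
  have hDD : ∀ x, innerDer F a (innerDer F a x) = t • innerDer F a x := by
    intro x
    have e1 : innerDer F a (innerDer F a x)
        = innerDer F (a * a) x + (x * (a * a) + x * (a * a))
          - (a * x * a + a * x * a) := by
      simp only [innerDer_apply]; noncomm_ring
    rw [e1, htwo, htwo, hsq, innerDer_smul_add_smul_one, add_zero, sub_zero]
  set V := LinearMap.range (innerDer F a)
  have hDV : ∀ v ∈ V, innerDer F a v = t • v := by
    rintro _ ⟨x, rfl⟩
    exact hDD x
  have hmV : ∀ v ∈ V, a * v ∈ V := by
    rintro _ ⟨x, rfl⟩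
    exact ⟨a * x, innerDer_self_mul a x⟩
  -- If every `x ∈ V` were an eigenvector, `a` would act on `V` as a scalar, making `a` central.
  obtain ⟨x, hxV, hxli⟩ : ∃ x ∈ V, LinearIndependent F ![x, a * x] := by
    by_contra! h
    let f : V →ₗ[F] V := (LinearMap.mulLeft F a).restrict (p := V) (q := V) hmV
    obtain ⟨c, hf⟩ := LinearMap.exists_eq_smul_id_of_forall_notLinearIndependent (f := f)
      (fun v hv => h v v.2 (by
        have := hv.map' V.subtype (Submodule.ker_subtype V)
        have e : V.subtype ∘ ![v, f v] = ![(v : B), a * v] := by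
          ext i; fin_cases i <;> rfl
        rwa [e] at this))
    refine ha (hc a (innerDer_eq_zero_of_mul_innerDer_eq_smul (c := c) fun x => ?_))
    exact congrArg Subtype.val (LinearMap.congr_fun hf ⟨innerDer F a x, x, rfl⟩)
  have hVspan : Submodule.span F {x, a * x} = V := by
    refine Submodule.eq_of_le_of_finrank_le ?_ ?_
    · rw [Submodule.span_le]
      rintro z (rfl | rfl)
      exacts [hxV, hmV x hxV]
    · have := finrank_span_eq_card hxli
      rw [Matrix.range_cons_cons_empty, Fintype.card_fin] at this
      rw [this, hV]
  have hxa : x * a = a * x - t • x := by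
    rw [← hDV x hxV, innerDer_apply]; abel
  have hxax : innerDer F x (a * x) = -(t • (x * x)) := by
    rw [innerDer_apply, ← mul_assoc, hxa, sub_mul, smul_mul_assoc]
    abel
  have hdec : ∀ w : B, ∃ c d : F, ∃ v ∈ V, w = (c • a + d • 1) + v := by
    intro w
    obtain ⟨c, d, h⟩ := hcent (w - t⁻¹ • innerDer F a w) (by
      rw [map_sub, map_smul, hDD, smul_smul, inv_mul_cancel₀ ht, one_smul, sub_self])
    exact ⟨c, d, _, V.smul_mem _ ⟨w, rfl⟩, sub_eq_iff_eq_add.1 h⟩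
  have hxxa : innerDer F a (x * x) = 0 := by
    rw [innerDer_mul, hDV x hxV, smul_mul_assoc, mul_smul_comm, htwo]
  -- `x²` commutes with `a` and `x`, which together with `1` generate the algebra.
  have hxx : x * x ∈ Set.range (algebraMap F B) := by
    have hx1 : innerDer F (x * x) x = 0 := by rw [innerDer_apply, mul_assoc, sub_self]
    have hx2 : innerDer F (x * x) a = 0 := by
      rw [innerDer_apply, sub_eq_zero] at hxxa ⊢
      exact hxxa.symm
    refine hc _ fun w => ?_
    obtain ⟨c, d, v, hv, rfl⟩ := hdec w
    rw [← hVspan] at hv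
    obtain ⟨e, f, rfl⟩ := Submodule.mem_span_pair.1 hv
    have hone : innerDer F (x * x) 1 = 0 := by rw [innerDer_apply, mul_one, one_mul, sub_self]
    simp only [map_add, map_smul, innerDer_mul, hx1, hx2, hone, smul_zero, add_zero, zero_mul,
      mul_zero]
  have hanti : ∀ p q : B, innerDer F p q = innerDer F q p := fun p q => by
    rw [innerDer_apply, innerDer_apply, ← hneg (q * p - p * q), neg_sub]
  -- The bracket is alternating, so on the plane spanned by `x`, `ax` it takes values in `F[x, ax] =
  -- F·tx² ⊆ F`.
  have hVV : ∀ v ∈ V, ∀ w ∈ V, innerDer F v w ∈ Submodule.span F {(1 : B)} := by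
    intro v hv w hw
    rw [← hVspan] at hv hw
    obtain ⟨e, f, rfl⟩ := Submodule.mem_span_pair.1 hv
    obtain ⟨e', f', rfl⟩ := Submodule.mem_span_pair.1 hw
    obtain ⟨k, hk⟩ := hxx
    have e1 : innerDer F (e • x + f • (a * x)) (e' • x + f' • (a * x))
        = (e * f' - f * e') • innerDer F x (a * x) := by
      simp only [innerDer_apply, add_mul, mul_add, smul_mul_assoc, mul_smul_comm, mul_assoc]
      module
    rw [e1, hxax, ← hk, Algebra.algebraMap_eq_smul_one, smul_smul]
    exact Submodule.smul_mem _ _ (neg_mem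
      (Submodule.smul_mem _ _ (Submodule.mem_span_singleton_self _)))
  have hKV : ∀ c d : F, ∀ v ∈ V, innerDer F (c • a + d • 1) v ∈ V := by
    rintro c d v hv
    rw [innerDer_smul_add_smul_one]
    exact V.smul_mem _ ⟨v, rfl⟩
  have haddl : ∀ p q r : B, innerDer F (p + q) r = innerDer F p r + innerDer F q r := by
    intro p q r
    simp only [innerDer_apply]; noncomm_ring
  obtain ⟨c, d, v, hv, rfl⟩ := hdec y
  obtain ⟨c', d', v', hv', rfl⟩ := hdec z
  have hKK : innerDer F (c • a + d • 1) (c' • a + d' • 1) = 0 := by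
    rw [innerDer_smul_add_smul_one, hanti, innerDer_smul_add_smul_one, innerDer_apply, sub_self,
      smul_zero, smul_zero]
  -- With `K = Fa + F`: `[K, K] = 0`, `[K, V] ⊆ V` and `[V, V] ⊆ F`.
  rw [map_add, haddl (c • a + d • 1), haddl (c • a + d • 1), hKK, zero_add]
  refine add_mem (Submodule.mem_sup_left ?_)
    (add_mem (Submodule.mem_sup_left (hKV _ _ _ hv')) (Submodule.mem_sup_right (hVV _ hv _ hv')))
  rw [hanti]
  exact hKV _ _ _ hv

/-- In a four-dimensional central simple algebra of characteristic two, `[a, B] ⊆ F a + F` for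
every sum `a` of commutators. -/
theorem innerDer_eq_smul_add_smul_one_of_mem_closure [IsSimpleRing B] [FiniteDimensional F B]
    (h2 : (2 : F) = 0)
    (hc : ∀ z : B, (∀ x, z * x = x * z) → z ∈ Set.range (algebraMap F B))
    (h4 : Module.finrank F B = 4) {a : B}
    (hmem : a ∈ AddSubgroup.closure {w : B | ∃ u v, w = u * v - v * u})
    (ha : a ∉ Set.range (algebraMap F B)) (x : B) :
    ∃ c d : F, innerDer F a x = c • a + d • 1 := by
  have hc' : ∀ z : B, (∀ x, innerDer F z x = 0) → z ∈ Set.range (algebraMap F B) :=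
    fun z hz => hc z fun x => sub_eq_zero.1 (hz x)
  have htwo : ∀ x : B, x + x = 0 := fun x => by rw [← two_smul F, h2, zero_smul]
  have hcent := (centralizer_eq_and_finrank_range_eq_two hc' h4 ha).1
  obtain ⟨t, n, hsq⟩ := hcent (a * a) (by rw [innerDer_apply, mul_assoc, sub_self])
  -- Otherwise `a = [a, w] + d`. Then `D_a²(w) = D_a(a - d) = 0`, yet it equals `t[a, w] = t(a -
  -- d)`, so `a = d ∈ F`.
  have ht : t = 0 := by
    by_contra ht
    have hle : AddSubgroup.closure {w : B | ∃ u v, w = u * v - v * u} ≤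
        (LinearMap.range (innerDer F a) ⊔ Submodule.span F {(1 : B)}).toAddSubgroup := by
      rw [AddSubgroup.closure_le]
      rintro _ ⟨u, v, rfl⟩
      exact innerDer_mem_range_sup_one h2 hc' h4 ha ht hsq u v
    obtain ⟨_, ⟨w, rfl⟩, e, he, h⟩ := Submodule.mem_sup.1 (hle hmem)
    obtain ⟨d, rfl⟩ := Submodule.mem_span_singleton.1 he
    have e1 : innerDer F a (innerDer F a w)
        = innerDer F (a * a) w + (w * (a * a) + w * (a * a))
          - (a * w * a + a * w * a) := by
      simp only [innerDer_apply]; noncomm_ring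
    rw [htwo, htwo, hsq, innerDer_smul_add_smul_one, add_zero, sub_zero,
      eq_sub_of_add_eq h] at e1
    have hd : innerDer F a (d • (1 : B)) = 0 := by
      rw [map_smul, innerDer_apply, mul_one, one_mul, sub_self, smul_zero]
    rw [map_sub, hd, sub_zero, innerDer_apply, sub_self, smul_sub, smul_smul, eq_comm,
      sub_eq_zero] at e1
    exact ha (smul_add_smul_one_mem_range ht (d := 0)
      (by rw [zero_smul, add_zero, e1]; exact ⟨t * d, Algebra.algebraMap_eq_smul_one _⟩))
  -- Now `D_a² = D_{a²} = 0`, so `[a, x]` centralizes `a`.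
  refine hcent _ ?_
  have e1 : innerDer F a (innerDer F a x)
      = innerDer F (a * a) x + (x * (a * a) + x * (a * a))
        - (a * x * a + a * x * a) := by
    simp only [innerDer_apply]; noncomm_ring
  rw [e1, htwo, htwo, hsq, innerDer_smul_add_smul_one, ht, zero_smul, add_zero, sub_zero]

end SimpleDimFour

/-! ### Prime artinian rings -/

/-- A prime artinian ring is simple. -/
theorem IsPrimeRing.isSimpleRing_of_isArtinianRing {B : Type*} [Ring B] [IsPrimeRing B]
    [IsArtinianRing B] : IsSimpleRing B := by
  -- By primeness a nonzero radical would have nonzero elements `x r y` in every power, but it is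
  -- nilpotent.
  have hJ : Ring.jacobson B = ⊥ := by
    by_contra hne
    obtain ⟨y, hy, hy0⟩ := Submodule.exists_mem_ne_zero_of_ne_bot hne
    have hpow : ∀ n : ℕ, ∃ x ∈ Ring.jacobson B ^ n, x ≠ 0 := by
      intro n
      induction n with
      | zero => exact ⟨1, by rw [Submodule.pow_zero]; exact Submodule.one_le.1 le_rfl, one_ne_zero⟩
      | succ n ih =>
        obtain ⟨x, hx, hx0⟩ := ih
        obtain ⟨r, hr⟩ : ∃ r, x * r * y ≠ 0 := by
          by_contra! h
          rcases IsPrimeRing.eq_zero_or_eq_zero x y h with h | h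
          exacts [hx0 h, hy0 h]
        refine ⟨x * r * y, ?_, hr⟩
        rw [Submodule.pow_succ, mul_assoc]
        exact Submodule.mul_mem_mul hx (Ideal.mul_mem_left _ r hy)
    obtain ⟨n, hn⟩ := IsSemiprimaryRing.isNilpotent (R := B)
    obtain ⟨x, hx, hx0⟩ := hpow n
    rw [hn] at hx
    exact hx0 (by simpa using hx)
  have : IsSemisimpleRing B := IsArtinianRing.isSemisimpleRing_iff_jacobson.2 hJ
  refine ⟨⟨fun I => or_iff_not_imp_left.2 fun hI => ?_⟩⟩
  -- For a complementary left ideal `N`, `x B y ⊆ I ∩ N = 0` for `x ∈ I`, `y ∈ N`, so `N = 0`.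
  obtain ⟨N, hN⟩ := exists_isCompl (TwoSidedIdeal.asIdeal I)
  obtain ⟨x, hx, hx0⟩ := TwoSidedIdeal.exists_ne_zero_of_ne_bot hI
  have hNbot : N = ⊥ := by
    refine (Submodule.eq_bot_iff _).2 fun y hy => ?_
    refine (IsPrimeRing.eq_zero_or_eq_zero x y fun r => ?_).resolve_left hx0
    have h1 : x * r * y ∈ TwoSidedIdeal.asIdeal I :=
      TwoSidedIdeal.mem_asIdeal.2 (I.mul_mem_right _ _ (I.mul_mem_right _ _ hx))
    exact Submodule.disjoint_def.1 hN.disjoint _ h1 (N.mul_mem_left _ hy)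
  have htop : TwoSidedIdeal.asIdeal I = ⊤ := by
    have := hN.sup_eq_top
    rwa [hNbot, sup_bot_eq] at this
  refine eq_top_iff.2 fun z _ => TwoSidedIdeal.mem_asIdeal.1 (htop ▸ Submodule.mem_top)

namespace PrimeRing

namespace SymmQuot

/-! ### Primeness of `Q_s(R)` and the extended centroid as a field -/

section MartindaleQuotient

variable {R : Type*} [NonUnitalRing R] [IsPrimeRing R]

theorem _root_.TwoSidedIdeal.eq_zero_of_forall_mul_eq_zero {I : TwoSidedIdeal R} (hI : I ≠ ⊥)
    {a : R} (h : ∀ x ∈ I, a * x = 0) : a = 0 := by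
  obtain ⟨x, hx, hx0⟩ := TwoSidedIdeal.exists_ne_zero_of_ne_bot hI
  refine (IsPrimeRing.eq_zero_or_eq_zero a x fun r => ?_).resolve_right hx0
  rw [mul_assoc]
  exact h _ (I.mul_mem_left _ _ hx)

theorem _root_.TwoSidedIdeal.eq_zero_of_forall_mul_eq_zero' {I : TwoSidedIdeal R} (hI : I ≠ ⊥)
    {a : R} (h : ∀ x ∈ I, x * a = 0) : a = 0 := by
  obtain ⟨x, hx, hx0⟩ := TwoSidedIdeal.exists_ne_zero_of_ne_bot hI
  exact (IsPrimeRing.eq_zero_or_eq_zero x a fun r =>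
    h _ (I.mul_mem_right _ _ hx)).resolve_left hx0

theorem ofRing_injective : Function.Injective (ofRing R) := by
  refine (injective_iff_map_eq_zero _).2 fun a ha => ?_
  obtain ⟨K, hK, -, -, h⟩ := Quotient.exact ha
  exact TwoSidedIdeal.eq_zero_of_forall_mul_eq_zero hK fun x hx =>
    (h x hx).1.trans (zero_mul x)

/-- The class of a balanced pair. -/
def mk (p : BalancedPair R) : SymmQuot R := Quotient.mk _ p

theorem exists_mk (q : SymmQuot R) : ∃ p, mk p = q := Quotient.exists_rep q

theorem mk_eq_mk {p q : BalancedPair R} (h : p ≈ q) : mk p = mk q := Quotient.sound h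

theorem ofRing_mul_mk (p : BalancedPair R) {x : R} (hx : x ∈ p.dom) :
    ofRing R x * mk p = ofRing R (p.r x) := by
  refine mk_eq_mk (p := .mul (.ofElem x) p) (q := .ofElem _)
    (BalancedPair.equiv_of_eq_on _ _ fun y hy => ?_)
  have hy := ((TwoSidedIdeal.mem_inf R).1
    (TwoSidedIdeal.square_le _ ((TwoSidedIdeal.mem_inf R).1 hy).1)).2
  exact ⟨p.balanced x hx y hy, p.r_mul x hx y⟩

theorem mk_mul_ofRing (p : BalancedPair R) {x : R} (hx : x ∈ p.dom) :
    mk p * ofRing R x = ofRing R (p.l x) := by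
  refine mk_eq_mk (p := .mul p (.ofElem x)) (q := .ofElem _)
    (BalancedPair.equiv_of_eq_on _ _ fun y hy => ?_)
  have hy := ((TwoSidedIdeal.mem_inf R).1
    (TwoSidedIdeal.square_le _ ((TwoSidedIdeal.mem_inf R).1 hy).1)).1
  exact ⟨p.l_mul x hx y, (p.balanced y hy x hx).symm⟩

/-- The left component vanishes on `I ⊓ p.dom`; the balance identity `(x q) y = x (q y)` then kills
the right one. -/
theorem eq_zero_of_mul_ofRing_eq_zero {I : TwoSidedIdeal R} (hI : I ≠ ⊥) {q : SymmQuot R}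
    (h : ∀ x ∈ I, q * ofRing R x = 0) : q = 0 := by
  obtain ⟨p, rfl⟩ := exists_mk q
  have hK := TwoSidedIdeal.inf_ne_bot hI p.dom_ne_bot
  have hl : ∀ x ∈ I ⊓ p.dom, p.l x = 0 := by
    intro x hx
    rw [TwoSidedIdeal.mem_inf] at hx
    refine ofRing_injective ?_
    rw [map_zero, ← mk_mul_ofRing p hx.2]
    exact h x hx.1
  refine mk_eq_mk (q := .ofElem 0) ⟨I ⊓ p.dom, hK, inf_le_right, fun x _ => TwoSidedIdeal.mem_top R,
    fun x hx => ⟨(hl x hx).trans (zero_mul x).symm, ?_⟩⟩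
  refine Eq.trans ?_ (mul_zero x).symm
  refine TwoSidedIdeal.eq_zero_of_forall_mul_eq_zero hK fun y hy => ?_
  rw [← p.balanced x ((TwoSidedIdeal.mem_inf R).1 hx).2 y ((TwoSidedIdeal.mem_inf R).1 hy).2,
    hl y hy, mul_zero]

theorem eq_zero_of_ofRing_mul_eq_zero {I : TwoSidedIdeal R} (hI : I ≠ ⊥) {q : SymmQuot R}
    (h : ∀ x ∈ I, ofRing R x * q = 0) : q = 0 := by
  obtain ⟨p, rfl⟩ := exists_mk q
  have hK := TwoSidedIdeal.inf_ne_bot hI p.dom_ne_bot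
  have hr : ∀ x ∈ I ⊓ p.dom, p.r x = 0 := by
    intro x hx
    rw [TwoSidedIdeal.mem_inf] at hx
    refine ofRing_injective ?_
    rw [map_zero, ← ofRing_mul_mk p hx.2]
    exact h x hx.1
  refine mk_eq_mk (q := .ofElem 0) ⟨I ⊓ p.dom, hK, inf_le_right, fun x _ => TwoSidedIdeal.mem_top R,
    fun x hx => ⟨?_, (hr x hx).trans (mul_zero x).symm⟩⟩
  refine Eq.trans ?_ (zero_mul x).symm
  refine TwoSidedIdeal.eq_zero_of_forall_mul_eq_zero' hK fun y hy => ?_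
  rw [p.balanced y ((TwoSidedIdeal.mem_inf R).1 hy).2 x ((TwoSidedIdeal.mem_inf R).1 hx).2,
    hr y hy, zero_mul]

/-- Elements of `Q_s(R)` are moved into `R` by a nonzero ideal. -/
theorem exists_ideal (q : SymmQuot R) : ∃ I : TwoSidedIdeal R, I ≠ ⊥ ∧
    ∀ x ∈ I, (∃ y, q * ofRing R x = ofRing R y) ∧ ∃ y, ofRing R x * q = ofRing R y := by
  obtain ⟨p, rfl⟩ := exists_mk q
  exact ⟨p.dom, p.dom_ne_bot, fun x hx =>
    ⟨⟨p.l x, mk_mul_ofRing p hx⟩, ⟨p.r x, ofRing_mul_mk p hx⟩⟩⟩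

/-- Suitable `x`, `y` in `R` make `xq` and `q'y` nonzero elements of `R`, where primeness applies.
Testing against `R` alone lets primeness pass to `unitalClosure R` too. -/
theorem eq_zero_or_eq_zero_of_mul_ofRing_mul {q q' : SymmQuot R}
    (h : ∀ r, q * ofRing R r * q' = 0) : q = 0 ∨ q' = 0 := by
  by_contra! hne
  obtain ⟨I, hI, hIq⟩ := exists_ideal q
  obtain ⟨J, hJ, hJq⟩ := exists_ideal q'
  obtain ⟨x, hx, hx0⟩ : ∃ x ∈ I, ofRing R x * q ≠ 0 := by
    by_contra! h
    exact hne.1 (eq_zero_of_ofRing_mul_eq_zero hI h)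
  obtain ⟨y, hy, hy0⟩ : ∃ y ∈ J, q' * ofRing R y ≠ 0 := by
    by_contra! h
    exact hne.2 (eq_zero_of_mul_ofRing_eq_zero hJ h)
  obtain ⟨a, ha⟩ := (hIq x hx).2
  obtain ⟨b, hb⟩ := (hJq y hy).1
  rcases IsPrimeRing.eq_zero_or_eq_zero a b fun r => ofRing_injective (by
    rw [map_mul, map_mul, ← ha, ← hb, map_zero, mul_assoc (ofRing R x),
      mul_assoc (ofRing R x), ← mul_assoc (q * ofRing R r), h, zero_mul, mul_zero]) with h0 | h0
  · exact hx0 (by rw [ha, h0, map_zero])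
  · exact hy0 (by rw [hb, h0, map_zero])

instance : IsPrimeRing (SymmQuot R) where
  exists_pair_ne := by
    obtain ⟨x, hx⟩ := exists_ne (0 : R)
    exact ⟨ofRing R x, 0, fun h => hx (ofRing_injective (by rw [h, map_zero]))⟩
  eq_zero_or_eq_zero _ _ h := eq_zero_or_eq_zero_of_mul_ofRing_mul fun r => h (ofRing R r)

/-- An element of `Q_s(R)` commuting with `R` is central. -/
theorem mem_center_of_forall_commute {z : SymmQuot R}
    (h : ∀ r, z * ofRing R r = ofRing R r * z) : z ∈ ExtCentroid R := by
  refine Subring.mem_center_iff.2 fun q => sub_eq_zero.1 ?_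
  obtain ⟨I, hI, hIq⟩ := exists_ideal q
  refine eq_zero_of_mul_ofRing_eq_zero hI fun x hx => ?_
  -- With `qx = y ∈ R`, both `qzx` and `zqx` equal `yz`.
  obtain ⟨y, hy⟩ := (hIq x hx).1
  rw [sub_mul, mul_assoc, mul_assoc, h, hy, h, ← mul_assoc, hy, sub_self]

/-- A nonzero central element of `Q_s(R)` is invertible: the inverse is defined on the image. -/
theorem exists_mul_eq_one_of_mem_center {c : SymmQuot R} (hc : c ∈ ExtCentroid R) (h0 : c ≠ 0) :
    ∃ d, c * d = 1 := by
  obtain ⟨p, rfl⟩ := exists_mk c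
  have hcomm := Subring.mem_center_iff.1 hc
  -- Centrality makes the two components agree, so `p.l` is a bimodule map; it is injective by
  -- primeness.
  have hlr : ∀ x ∈ p.dom, p.l x = p.r x := fun x hx => ofRing_injective (by
    rw [← mk_mul_ofRing p hx, ← ofRing_mul_mk p hx, hcomm])
  have hinj0 : ∀ x ∈ p.dom, p.l x = 0 → x = 0 := by
    intro x hx h
    have : ofRing R x = 0 := by
      refine (eq_zero_or_eq_zero_of_mul_ofRing_mul fun r => ?_).resolve_left h0
      rw [← hcomm, mul_assoc, mk_mul_ofRing p hx, h, map_zero, mul_zero]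
    exact ofRing_injective (this.trans (map_zero _).symm)
  have hsub : ∀ x ∈ p.dom, ∀ y ∈ p.dom, p.l (x - y) = p.l x - p.l y := by
    intro x hx y hy
    rw [sub_eq_add_neg, p.l_add x hx _ (p.dom.neg_mem hy), p.l_neg hy, ← sub_eq_add_neg]
  have hinj : ∀ x ∈ p.dom, ∀ y ∈ p.dom, p.l x = p.l y → x = y := fun x hx y hy h =>
    sub_eq_zero.1 (hinj0 _ (p.dom.sub_mem hx hy) (by rw [hsub x hx y hy, h, sub_self]))
  have hlmul : ∀ x ∈ p.dom, ∀ s, p.l (s * x) = s * p.l x := fun x hx s => by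
    rw [hlr _ (p.dom.mul_mem_left _ _ hx), hlr x hx, p.r_mul x hx]
  let J : TwoSidedIdeal R := TwoSidedIdeal.mk' {w | ∃ x ∈ p.dom, p.l x = w}
    ⟨0, p.dom.zero_mem, p.l_zero⟩
    (by
      rintro _ _ ⟨x, hx, rfl⟩ ⟨y, hy, rfl⟩
      exact ⟨x + y, p.dom.add_mem hx hy, p.l_add x hx y hy⟩)
    (by
      rintro _ ⟨x, hx, rfl⟩
      exact ⟨-x, p.dom.neg_mem hx, p.l_neg hx⟩)
    (by
      rintro s _ ⟨x, hx, rfl⟩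
      exact ⟨s * x, p.dom.mul_mem_left _ _ hx, hlmul x hx s⟩)
    (by
      rintro _ s ⟨x, hx, rfl⟩
      exact ⟨x * s, p.dom.mul_mem_right _ _ hx, p.l_mul x hx s⟩)
  have hJ : ∀ w, w ∈ J ↔ ∃ x ∈ p.dom, p.l x = w := fun w =>
    TwoSidedIdeal.mem_mk' _ _ _ _ _ _ _
  have hJbot : J ≠ ⊥ := by
    obtain ⟨x, hx, hx0⟩ := TwoSidedIdeal.exists_ne_zero_of_ne_bot p.dom_ne_bot
    exact TwoSidedIdeal.ne_bot_of_mem ((hJ _).2 ⟨x, hx, rfl⟩) fun h => hx0 (hinj0 x hx h)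
  choose! g hgdom hg using fun w hw => (hJ w).1 hw
  have hgl : ∀ x ∈ p.dom, g (p.l x) = x := fun x hx =>
    have hm : p.l x ∈ J := (hJ _).2 ⟨x, hx, rfl⟩
    hinj _ (hgdom _ hm) _ hx (hg _ hm)
  have hgadd : ∀ x ∈ J, ∀ y ∈ J, g (x + y) = g x + g y := fun x hx y hy => by
    conv_lhs => rw [← hg x hx, ← hg y hy, ← p.l_add _ (hgdom x hx) _ (hgdom y hy)]
    exact hgl _ (p.dom.add_mem (hgdom x hx) (hgdom y hy))
  have hgmul : ∀ x ∈ J, ∀ s, g (x * s) = g x * s := fun x hx s => by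
    conv_lhs => rw [← hg x hx, ← p.l_mul _ (hgdom x hx)]
    exact hgl _ (p.dom.mul_mem_right _ _ (hgdom x hx))
  have hgmul' : ∀ x ∈ J, ∀ s, g (s * x) = s * g x := fun x hx s => by
    conv_lhs => rw [← hg x hx, ← hlmul _ (hgdom x hx)]
    exact hgl _ (p.dom.mul_mem_left _ _ (hgdom x hx))
  refine ⟨mk
    { dom := J, dom_ne_bot := hJbot, l := g, r := g, l_add := hgadd, l_mul := hgmul,
      r_add := hgadd, r_mul := hgmul', balanced := fun x hx y hy => ?_ }, ?_⟩
  · rw [← hgmul' y hy, ← hgmul x hx]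
  · refine mk_eq_mk (p := .mul p _) (q := .one) (BalancedPair.equiv_of_eq_on _ _ fun x hx => ?_)
    have hx := (TwoSidedIdeal.mem_inf R).1
      (TwoSidedIdeal.square_le _ ((TwoSidedIdeal.mem_inf R).1 hx).1)
    exact ⟨hg x hx.2, (congrArg g (hlr x hx.1).symm).trans (hgl x hx.1)⟩

theorem isField_extCentroid : IsField (ExtCentroid R) where
  exists_pair_ne := exists_pair_ne _
  mul_comm := mul_comm
  mul_inv_cancel := by
    rintro ⟨c, hc⟩ h0
    have hc0 : c ≠ 0 := fun h => h0 (Subtype.ext h)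
    obtain ⟨d, hd⟩ := exists_mul_eq_one_of_mem_center hc hc0
    have hcomm := Subring.mem_center_iff.1 hc
    refine ⟨⟨d, Subring.mem_center_iff.2 fun q => ?_⟩, Subtype.ext hd⟩
    calc q * d = d * c * (q * d) := by rw [hcomm, hd, one_mul]
      _ = d * (c * q) * d := by noncomm_ring
      _ = d * q * (c * d) := by rw [← hcomm]; noncomm_ring
      _ = d * q := by rw [hd, mul_one]

end MartindaleQuotient

end SymmQuot

end PrimeRing

/-! ### The central closure and the two implications -/

namespace PrimeRing

section CentralClosure

variable {R : Type*} [NonUnitalRing R] [IsPrimeRing R]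

theorem centralClosure_mul_mem {x y : SymmQuot R} (hx : x ∈ centralClosure R)
    (hy : y ∈ centralClosure R) : x * y ∈ centralClosure R := by
  refine Submodule.span_induction₂ (p := fun x y _ _ => x * y ∈ centralClosure R)
    ?_ ?_ ?_ ?_ ?_ ?_ ?_ hx hy
  · rintro _ _ ⟨a, rfl⟩ ⟨b, rfl⟩
    exact Submodule.subset_span ⟨a * b, map_mul _ _ _⟩
  · intro y _
    rw [zero_mul]; exact zero_mem _
  · intro x _
    rw [mul_zero]; exact zero_mem _
  · intro x y z _ _ _ h h'
    rw [add_mul]; exact add_mem h h'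
  · intro x y z _ _ _ h h'
    rw [mul_add]; exact add_mem h h'
  · intro c x y _ _ h
    rw [smul_mul_assoc]; exact Submodule.smul_mem _ _ h
  · intro c x y _ _ h
    rw [mul_smul_comm]; exact Submodule.smul_mem _ _ h

variable (R) in
/-- The unital subalgebra `RC + C` of `Q_s(R)`. -/
def unitalClosure : Subalgebra (ExtCentroid R) (SymmQuot R) :=
  (centralClosure R ⊔ Submodule.span (ExtCentroid R) {1}).toSubalgebra
    (Submodule.mem_sup_right (Submodule.mem_span_singleton_self _)) (by
      intro x y hx hy
      obtain ⟨u, hu, e, he, rfl⟩ := Submodule.mem_sup.1 hx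
      obtain ⟨v, hv, f, hf, rfl⟩ := Submodule.mem_sup.1 hy
      obtain ⟨c, rfl⟩ := Submodule.mem_span_singleton.1 he
      obtain ⟨d, rfl⟩ := Submodule.mem_span_singleton.1 hf
      rw [add_mul, mul_add, mul_add, smul_mul_assoc, mul_smul_comm, mul_one, one_mul,
        smul_mul_assoc, one_mul]
      exact add_mem (Submodule.mem_sup_left
          (add_mem (centralClosure_mul_mem hu hv) (Submodule.smul_mem _ _ hu)))
        (add_mem (Submodule.mem_sup_left (Submodule.smul_mem _ _ hv))
          (Submodule.mem_sup_right (Submodule.smul_mem _ _ hf))))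

theorem toSubmodule_unitalClosure : Subalgebra.toSubmodule (unitalClosure R) =
    centralClosure R ⊔ Submodule.span (ExtCentroid R) {1} :=
  Submodule.toSubalgebra_toSubmodule _ _ _

theorem centralClosure_le_unitalClosure {x : SymmQuot R} (hx : x ∈ centralClosure R) :
    x ∈ unitalClosure R := by
  rw [← Subalgebra.mem_toSubmodule, toSubmodule_unitalClosure]
  exact Submodule.mem_sup_left hx

theorem ofRing_mem_centralClosure (r : R) : SymmQuot.ofRing R r ∈ centralClosure R :=
  Submodule.subset_span ⟨r, rfl⟩

theorem exists_eq_add_smul_one_of_mem_unitalClosure {x : SymmQuot R} (hx : x ∈ unitalClosure R) :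
    ∃ u ∈ centralClosure R, ∃ c : ExtCentroid R, x = u + c • 1 := by
  rw [← Subalgebra.mem_toSubmodule, toSubmodule_unitalClosure] at hx
  obtain ⟨u, hu, e, he, rfl⟩ := Submodule.mem_sup.1 hx
  obtain ⟨c, rfl⟩ := Submodule.mem_span_singleton.1 he
  exact ⟨u, hu, c, rfl⟩

theorem toSubmodule_unitalClosure_eq (h1 : (1 : SymmQuot R) ∈ centralClosure R) :
    Subalgebra.toSubmodule (unitalClosure R) = centralClosure R := by
  rw [toSubmodule_unitalClosure, sup_eq_left, Submodule.span_singleton_le_iff_mem]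
  exact h1

instance : IsPrimeRing (unitalClosure R) where
  exists_pair_ne := ⟨0, 1, fun h => zero_ne_one (congrArg Subtype.val h)⟩
  eq_zero_or_eq_zero a b h := by
    refine (SymmQuot.eq_zero_or_eq_zero_of_mul_ofRing_mul (q := (a : SymmQuot R)) (q' := b)
      fun r => ?_).imp Subtype.ext Subtype.ext
    exact congrArg Subtype.val
      (h ⟨_, centralClosure_le_unitalClosure (ofRing_mem_centralClosure r)⟩)

theorem mem_range_algebraMap_unitalClosure_iff (z : unitalClosure R) :
    z ∈ Set.range (algebraMap (ExtCentroid R) (unitalClosure R)) ↔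
      (z : SymmQuot R) ∈ ExtCentroid R :=
  ⟨by rintro ⟨c, rfl⟩; exact c.2, fun h => ⟨⟨z, h⟩, rfl⟩⟩

theorem mem_range_algebraMap_of_forall_commute (z : unitalClosure R)
    (h : ∀ x, z * x = x * z) :
    z ∈ Set.range (algebraMap (ExtCentroid R) (unitalClosure R)) :=
  (mem_range_algebraMap_unitalClosure_iff z).2 (SymmQuot.mem_center_of_forall_commute fun r =>
    congrArg Subtype.val
      (h ⟨_, centralClosure_le_unitalClosure (ofRing_mem_centralClosure r)⟩))

theorem exists_ne_mul_unitalClosure (hR : ∃ x y : R, x * y ≠ y * x) :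
    ∃ u v : unitalClosure R, u * v ≠ v * u := by
  obtain ⟨x, y, h⟩ := hR
  refine ⟨⟨_, centralClosure_le_unitalClosure (ofRing_mem_centralClosure x)⟩,
    ⟨_, centralClosure_le_unitalClosure (ofRing_mem_centralClosure y)⟩, fun e => h ?_⟩
  have := congrArg Subtype.val e
  refine SymmQuot.ofRing_injective ?_
  rw [map_mul, map_mul]
  exact this

/-- Scalars drop out of commutators, so passing from `RC` to `RC + C` creates no new ones. -/
theorem mul_sub_mul_mem_commutator {u v : SymmQuot R} (hu : u ∈ unitalClosure R)
    (hv : v ∈ unitalClosure R) : u * v - v * u ∈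
      commutator (centralClosure R).toAddSubgroup (centralClosure R).toAddSubgroup := by
  obtain ⟨u, hu', c, rfl⟩ := exists_eq_add_smul_one_of_mem_unitalClosure hu
  obtain ⟨v, hv', d, rfl⟩ := exists_eq_add_smul_one_of_mem_unitalClosure hv
  refine AddSubgroup.subset_closure ⟨u, hu', v, hv', ?_⟩
  simp only [add_mul, mul_add, smul_mul_assoc, mul_smul_comm, one_mul, mul_one]
  module

theorem mem_affineLine_iff {a x : SymmQuot R} :
    x ∈ affineLine a ↔ ∃ c d : ExtCentroid R, x = c • a + d • 1 := by
  rw [affineLine, Submodule.mem_toAddSubgroup, ← Submodule.span_insert,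
    Submodule.mem_span_pair]
  simp only [eq_comm]

theorem two_eq_zero_iff_exponent_eq_two :
    (2 : ExtCentroid R) = 0 ↔ AddMonoid.exponent R = 2 := by
  constructor
  · intro h
    have hdvd : AddMonoid.exponent R ∣ 2 := by
      refine AddMonoid.exponent_dvd_iff_forall_nsmul_eq_zero.2 fun r => ?_
      refine SymmQuot.ofRing_injective ?_
      rw [map_nsmul, map_zero, two_nsmul, ← two_smul (ExtCentroid R), h, zero_smul]
    refine (Nat.prime_two.eq_one_or_self_of_dvd _ hdvd).resolve_left fun h1 => ?_
    exact not_subsingleton R (AddMonoid.exp_eq_one_iff.1 h1)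
  · intro h
    refine Subtype.ext ?_
    obtain ⟨x, hx⟩ := exists_ne (0 : R)
    refine SymmQuot.eq_zero_of_mul_ofRing_eq_zero
      (TwoSidedIdeal.ne_bot_of_mem (TwoSidedIdeal.mem_top R) hx) fun r _ => ?_
    have h2 : (2 : ℕ) • r = 0 :=
      AddMonoid.exponent_dvd_iff_forall_nsmul_eq_zero.1 (dvd_of_eq h) r
    change (2 : SymmQuot R) * _ = 0
    rw [two_mul, ← map_add, ← two_nsmul, h2, map_zero]

/-- `RC` is a nonzero two-sided ideal of `RC + C`, which is prime and finite-dimensional, hence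
simple. -/
theorem one_mem_centralClosure_of_finite [Module.Finite (ExtCentroid R) (centralClosure R)] :
    (1 : SymmQuot R) ∈ centralClosure R := by
  let _ : Field (ExtCentroid R) := SymmQuot.isField_extCentroid.toField
  have : Module.Finite (ExtCentroid R) (unitalClosure R) := by
    change Module.Finite (ExtCentroid R) (Subalgebra.toSubmodule (unitalClosure R))
    rw [toSubmodule_unitalClosure]
    infer_instance
  have : IsArtinianRing (unitalClosure R) := IsArtinianRing.of_finite (ExtCentroid R) _
  have := IsPrimeRing.isSimpleRing_of_isArtinianRing (B := unitalClosure R)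
  let I : TwoSidedIdeal (unitalClosure R) :=
    TwoSidedIdeal.mk' {w | (w : SymmQuot R) ∈ centralClosure R} (zero_mem (centralClosure R))
      (fun hx hy => (centralClosure R).add_mem hx hy)
      (fun hx => (centralClosure R).neg_mem hx)
      (by
        rintro s w hw
        obtain ⟨u, hu, c, e⟩ := exists_eq_add_smul_one_of_mem_unitalClosure s.2
        change (s : SymmQuot R) * w ∈ centralClosure R
        rw [e, add_mul, smul_mul_assoc, one_mul]
        exact add_mem (centralClosure_mul_mem hu hw) (Submodule.smul_mem _ _ hw))
      (by
        rintro w s hw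
        obtain ⟨u, hu, c, e⟩ := exists_eq_add_smul_one_of_mem_unitalClosure s.2
        change (w : SymmQuot R) * s ∈ centralClosure R
        rw [e, mul_add, mul_smul_comm, mul_one]
        exact add_mem (centralClosure_mul_mem hw hu) (Submodule.smul_mem _ _ hw))
  have hI : ∀ w, w ∈ I ↔ (w : SymmQuot R) ∈ centralClosure R :=
    fun w => TwoSidedIdeal.mem_mk' _ _ _ _ _ _ _
  obtain ⟨r, hr⟩ := exists_ne (0 : R)
  have hbot : I ≠ ⊥ := by
    refine TwoSidedIdeal.ne_bot_of_mem
      (x := ⟨_, centralClosure_le_unitalClosure (ofRing_mem_centralClosure r)⟩)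
      ((hI _).2 (ofRing_mem_centralClosure r)) fun h => hr ?_
    exact SymmQuot.ofRing_injective ((congrArg Subtype.val h).trans (map_zero _).symm)
  have htop : I = ⊤ := (eq_bot_or_eq_top I).resolve_left hbot
  exact (hI 1).1 (htop ▸ TwoSidedIdeal.mem_top _)

theorem isExceptional_of_isLieIdealOf (hR : ∃ x y : R, x * y ≠ y * x)
    (H : ∀ a ∈ commutator (centralClosure R).toAddSubgroup (centralClosure R).toAddSubgroup,
      a ∉ ExtCentroid R → IsLieIdealOf (affineLine a) (centralClosure R).toAddSubgroup) :
    IsExceptional R := by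
  let _ : Field (ExtCentroid R) := SymmQuot.isField_extCentroid.toField
  have hS := exists_ne_mul_unitalClosure hR
  obtain ⟨u, v, huv⟩ := exists_commutator_notMem_range (F := ExtCentroid R) hS
  rw [mem_range_algebraMap_unitalClosure_iff] at huv
  -- A Lie ideal of `RC` is contained in `RC`, and `Ca + C` contains `1`.
  have h1 : (1 : SymmQuot R) ∈ centralClosure R :=
    (H _ (mul_sub_mul_mem_commutator u.2 v.2) huv).1
      (mem_affineLine_iff.2 ⟨0, 1, by rw [zero_smul, zero_add, one_smul]⟩)
  have hEq := toSubmodule_unitalClosure_eq h1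
  have key := two_eq_zero_and_finrank_eq_four (F := ExtCentroid R) hS
    mem_range_algebraMap_of_forall_commute (fun u v huv x => by
      rw [mem_range_algebraMap_unitalClosure_iff] at huv
      have hx : (x : SymmQuot R) ∈ centralClosure R := by
        rw [← hEq]; exact x.2
      obtain ⟨c, d, h⟩ := mem_affineLine_iff.1
        ((H _ (mul_sub_mul_mem_commutator u.2 v.2) huv).2 (AddSubgroup.subset_closure
          ⟨_, mem_affineLine_iff.2 ⟨1, 0, by rw [zero_smul, add_zero, one_smul]⟩, _, hx, rfl⟩))
      exact ⟨c, d, Subtype.ext h⟩)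
  refine ⟨two_eq_zero_iff_exponent_eq_two.1 key.1, ?_⟩
  rw [← hEq]
  exact key.2

theorem exists_mem_closure_unitalClosure {a : SymmQuot R}
    (ha : a ∈ commutator (centralClosure R).toAddSubgroup (centralClosure R).toAddSubgroup) :
    ∃ b : unitalClosure R, (b : SymmQuot R) = a ∧
      b ∈ AddSubgroup.closure {w : unitalClosure R | ∃ u v, w = u * v - v * u} := by
  refine AddSubgroup.closure_induction (p := fun a _ => ∃ b : unitalClosure R,
    (b : SymmQuot R) = a ∧
      b ∈ AddSubgroup.closure {w : unitalClosure R | ∃ u v, w = u * v - v * u}) ?_ ?_ ?_ ?_ ha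
  · rintro _ ⟨u, hu, v, hv, rfl⟩
    exact ⟨_, rfl, AddSubgroup.subset_closure
      ⟨⟨u, centralClosure_le_unitalClosure hu⟩, ⟨v, centralClosure_le_unitalClosure hv⟩, rfl⟩⟩
  · exact ⟨0, rfl, zero_mem _⟩
  · rintro _ _ _ _ ⟨b, rfl, hb⟩ ⟨b', rfl, hb'⟩
    exact ⟨b + b', rfl, add_mem hb hb'⟩
  · rintro _ _ ⟨b, rfl, hb⟩
    exact ⟨-b, rfl, neg_mem hb⟩

theorem isLieIdealOf_affineLine_of_isExceptional (hR : IsExceptional R) {a : SymmQuot R}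
    (ha : a ∈ commutator (centralClosure R).toAddSubgroup (centralClosure R).toAddSubgroup)
    (haC : a ∉ ExtCentroid R) :
    IsLieIdealOf (affineLine a) (centralClosure R).toAddSubgroup := by
  let _ : Field (ExtCentroid R) := SymmQuot.isField_extCentroid.toField
  obtain ⟨hexp, h4⟩ := hR
  -- `finrank` is zero in infinite dimension, so the value four guarantees finiteness.
  have : Module.Finite (ExtCentroid R) (centralClosure R) :=
    Module.finite_of_finrank_eq_succ h4
  have h1 := one_mem_centralClosure_of_finite (R := R)
  have hEq := toSubmodule_unitalClosure_eq h1
  have h4' : Module.finrank (ExtCentroid R) (unitalClosure R) = 4 := by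
    rw [← hEq] at h4
    exact h4
  have : Module.Finite (ExtCentroid R) (unitalClosure R) :=
    Module.finite_of_finrank_eq_succ h4'
  have : IsArtinianRing (unitalClosure R) := IsArtinianRing.of_finite (ExtCentroid R) _
  have := IsPrimeRing.isSimpleRing_of_isArtinianRing (B := unitalClosure R)
  obtain ⟨b, rfl, hb⟩ := exists_mem_closure_unitalClosure ha
  have hbA : (b : SymmQuot R) ∈ centralClosure R := by
    rw [← hEq]; exact b.2
  constructor
  · intro x hx
    obtain ⟨c, d, rfl⟩ := mem_affineLine_iff.1 hx
    exact add_mem (S := Submodule _ _) (Submodule.smul_mem _ _ hbA) (Submodule.smul_mem _ _ h1)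
  · refine (AddSubgroup.closure_le _).2 ?_
    rintro _ ⟨l, hl, x, hx, rfl⟩
    obtain ⟨c, d, rfl⟩ := mem_affineLine_iff.1 hl
    obtain ⟨c', d', h⟩ := innerDer_eq_smul_add_smul_one_of_mem_closure (F := ExtCentroid R)
      (two_eq_zero_iff_exponent_eq_two.2 hexp) mem_range_algebraMap_of_forall_commute h4' hb
      (by rwa [mem_range_algebraMap_unitalClosure_iff])
      ⟨x, centralClosure_le_unitalClosure hx⟩
    have h' : (b : SymmQuot R) * x - x * b = c' • (b : SymmQuot R) + d' • 1 :=
      congrArg Subtype.val h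
    refine mem_affineLine_iff.2 ⟨c * c', c * d', ?_⟩
    have e := innerDer_smul_add_smul_one c d (b : SymmQuot R) x
    rw [innerDer_apply, innerDer_apply, h'] at e
    rw [e, smul_add, smul_smul, smul_smul]

end CentralClosure

end PrimeRing

theorem mainTheorem11 {R : Type*} [NonUnitalRing R] [IsPrimeRing R]
    (hR : ∃ x y : R, x * y ≠ y * x) :
    PrimeRing.IsExceptional R ↔
      ∀ a ∈ PrimeRing.commutator (PrimeRing.centralClosure R).toAddSubgroup
          (PrimeRing.centralClosure R).toAddSubgroup,
        a ∉ PrimeRing.ExtCentroid R →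
          PrimeRing.IsLieIdealOf (PrimeRing.affineLine a)
            (PrimeRing.centralClosure R).toAddSubgroup :=
  ⟨fun h _ ha haC => PrimeRing.isLieIdealOf_affineLine_of_isExceptional h ha haC,
    PrimeRing.isExceptional_of_isLieIdealOf hR⟩
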